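/- Let $n_1,n_2$ be natural numbers, let $\mathcal X$ and $\mathcal Y$ be standard Borel spaces ($\mathcal Y$ non-empty), and let $\mathbf X=(X_{i,j})$ and $\mathbf Y=(Y_{i,j})$ be $\mathcal X$- and $\mathcal Y$-valued random arrays indexed by $[n_1]\times[n_2]$, on a probability space that is rich enough to carry a uniform random variable on $[0,1]$ independent of $(\mathbf X,\mathbf Y)$. A pair of permutations $(\pi_1,\pi_2)\in\mathbb S_{n_1}\times\mathbb S_{n_2}$ acts on arrays by $[(\pi_1,\pi_2)\cdot\mathbf x]_{i,j}=x_{\pi_1(i),\pi_2(j)}$. Fix a measurable canonical form $\mathrm{Canon}$ for $\mathcal X^3$-valued $n_1\times n_2$ arrays, that is, a measurable map which selects one representative from each orbit of this action, and define the separately augmented canonical form of $\mathbf X$ at $(i,j)$ as the canonical form of $\mathbf X$ with its $i$th row and $j$th column broadcast over the array, $$\mathbf C^{(i,j)}_{\mathbf X}=\mathrm{Canon}\Big(\big(X_{k,\ell},\,X_{i,\ell},\,X_{k,j}\big)_{k\in[n_1],\,\ell\in[n_2]}\Big).$$ Suppose that $\mathbf X$ is separately exchangeable, i.e. $g\cdot\mathbf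 X\overset{d}{=}\mathbf X$ for all $g\in\mathbb S_{n_1}\times\mathbb S_{n_2}$, and that the entries of $\mathbf Y$ are mutually conditionally independent given $\mathbf X$. Then $\mathbf Y$ is conditionally $\mathbb S_{n_1}\times\mathbb S_{n_2}$-equivariant given $\mathbf X$ (for every $g$, the conditional distribution of $g\cdot\mathbf Y$ given $g\cdot\mathbf X$ equals the conditional distribution of $\mathbf Y$ given $\mathbf X$) if and only if there are a measurable function $f:[0,1]\times\mathcal X\times(\mathcal X^3)^{n_1\times n_2}\to\mathcal Y$ and i.i.d. uniform random variables $(\eta_{i,j})_{i\in[n_1],\,j\in[n_2]}$ on $[0,1]$, the array $(\eta_{i,j})$ being independent of $\mathbf X$, such that almost surely $$Y_{i,j}=f\big(\eta_{i,j},\,X_{i,j},\,\mathbf C^{(i,j)}_{\mathbf X}\big)\qquad\text{for all } i\in[n_1],\ j\in[n_2].$$ -/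

import Mathlib

open MeasureTheory ProbabilityTheory

/-- `n₁ × n₂` arrays with entries in `A` (with the product sigma-algebra). -/
abbrev Arr (n₁ n₂ : ℕ) (A : Type*) : Type _ := Fin n₁ → Fin n₂ → A

/-- The group `S_{n₁} × S_{n₂}`. -/
abbrev SepPerm (n₁ n₂ : ℕ) : Type := Equiv.Perm (Fin n₁) × Equiv.Perm (Fin n₂)

/-- A pair of permutations acts on arrays, separately on rows and columns:
`[g · x]_{i,j} = x_{π₁(i), π₂(j)}` for `g = (π₁, π₂)`. -/
def permAct {n₁ n₂ : ℕ} {A : Type*} (g : SepPerm n₁ n₂) (x : Arr n₁ n₂ A) : Arr n₁ n₂ A :=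
  fun i j => x (g.1 i) (g.2 j)

/-- The law of the random array `X` is invariant under separate permutations of rows and
columns. -/
def SeparatelyExchangeable {Ω : Type*} [MeasurableSpace Ω] {n₁ n₂ : ℕ} {A : Type*}
    [MeasurableSpace A] (X : Ω → Arr n₁ n₂ A) (μ : Measure Ω) : Prop :=
  ∀ g : SepPerm n₁ n₂, μ.map (fun ω => permAct g (X ω)) = μ.map X

/-- The entries of the random array `Y` are mutually conditionally independent given (the
sigma-algebra generated by) `X`. Some of the sets may be the whole space, so that the product
formula also covers all subfamilies of entries. -/
def CondIndepEntries {Ω : Type*} [MeasurableSpace Ω] {n₁ n₂ : ℕ} {A B : Type*}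
    [MeasurableSpace A] [MeasurableSpace B]
    (X : Ω → Arr n₁ n₂ A) (Y : Ω → Arr n₁ n₂ B) (μ : Measure Ω) : Prop :=
  ∀ S : Fin n₁ → Fin n₂ → Set B, (∀ i j, MeasurableSet (S i j)) →
    μ⟦⋂ i, ⋂ j, {ω | Y ω i j ∈ S i j} | MeasurableSpace.comap X inferInstance⟧
      =ᵐ[μ] ∏ i, ∏ j, μ⟦{ω | Y ω i j ∈ S i j} | MeasurableSpace.comap X inferInstance⟧

/-- Conditional equivariance of `Y` given `X` under `S_{n₁} × S_{n₂}`: the conditional law of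
`g · Y` given `g · X` is the conditional law of `Y` given `X`, for every `g`. -/
def CondEquivariant {Ω : Type*} [MeasurableSpace Ω] {n₁ n₂ : ℕ} {A B : Type*}
    [MeasurableSpace A] [MeasurableSpace B] [StandardBorelSpace B] [Nonempty B]
    (X : Ω → Arr n₁ n₂ A) (Y : Ω → Arr n₁ n₂ B) (μ : Measure Ω) [IsFiniteMeasure μ] : Prop :=
  ∀ g : SepPerm n₁ n₂,
    ∀ᵐ x ∂(μ.map X),
      condDistrib (fun ω => permAct g (Y ω)) (fun ω => permAct g (X ω)) μ x
        = condDistrib Y X μ x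

/-- A canonical form on `A`-valued arrays: a measurable choice of one representative in each
orbit of `S_{n₁} × S_{n₂}`. -/
structure IsCanonicalForm {n₁ n₂ : ℕ} {A : Type*} [MeasurableSpace A]
    (canon : Arr n₁ n₂ A → Arr n₁ n₂ A) : Prop where
  measurable : Measurable canon
  mem_orbit : ∀ z, ∃ g : SepPerm n₁ n₂, canon z = permAct g z
  invariant : ∀ (g : SepPerm n₁ n₂) z, canon (permAct g z) = canon z

/-- The array `x` with its `i`-th row and its `j`-th column broadcast to the entire array. -/
def broadcast {n₁ n₂ : ℕ} {A : Type*} (x : Arr n₁ n₂ A) (i : Fin n₁) (j : Fin n₂) :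
    Arr n₁ n₂ (A × A × A) :=
  fun k l => (x k l, x i l, x k j)

/-- The separately augmented canonical form of `x` at `(i, j)`: the canonical form of `x`
augmented entrywise with its `i`-th row and `j`-th column. Its entries are
`(x_{σ(k),τ(l)}, x_{i,τ(l)}, x_{σ(k),j})`, where `(σ, τ)` are the permutations that the
canonicalization applies; in particular the first coordinates form an orbit representative
of `x`. -/
def augCanon {n₁ n₂ : ℕ} {A : Type*}
    (canon : Arr n₁ n₂ (A × A × A) → Arr n₁ n₂ (A × A × A))
    (x : Arr n₁ n₂ A) (i : Fin n₁) (j : Fin n₂) : Arr n₁ n₂ (A × A × A) :=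
  canon (broadcast x i j)

/-- `η` is an array of i.i.d. uniform random variables on `[0,1]`. -/
structure IsIIDUniform {Ω : Type*} [MeasurableSpace Ω] {n₁ n₂ : ℕ}
    (η : Ω → Arr n₁ n₂ unitInterval) (μ : Measure Ω) : Prop where
  measurable : Measurable η
  uniform : ∀ i j, μ.map (fun ω => η ω i j) = volume
  indep : iIndepFun (fun (p : Fin n₁ × Fin n₂) ω => η ω p.1 p.2) μ

/-! Write κ_{ij}(x) for the conditional law of Y_{ij} given X = x. Over an exchangeable X,
conditional equivariance says that the joint law of (X, Y) is invariant, so that κ_{g(i,j)}(x) =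
κ_{ij}(g·x) for almost every x (`CondEquivariant.condDistrib_entry`). Hence κ_{ij}(x) depends only
on the orbit of x with position (i,j) marked, and the augmented canonical form records that orbit: a
position whose row and column agree with the broadcast ones serves as the mark. Such a position need
not be unique, but any choice works, because swapping equal rows or equal columns leaves x unchanged
(`IsMarkedPosition.exists_permAct_eq`). Selecting one measurably gives a single f generating every
κ_{ij} from uniform noise. Conditional independence assembles the entries into the joint law
(`CondIndepEntries.map_prodMk_eq`), and the spare uniform variable turns equality in law into almost
sure equality (`exists_ae_eq_of_map_eq`). Conversely, the representation commutes with permutations,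
and (X, η) has a permutation-invariant law. -/

/-! ### Boxes as a determining class for laws of arrays -/

section Boxes

variable {n₁ n₂ : ℕ} {B : Type*} [MeasurableSpace B]

/-- The arrays all of whose entries lie in prescribed measurable sets. -/
def arrBoxes (n₁ n₂ : ℕ) (B : Type*) [MeasurableSpace B] : Set (Set (Arr n₁ n₂ B)) :=
  Set.pi Set.univ '' Set.pi Set.univ fun _ =>
    Set.pi Set.univ '' Set.pi Set.univ fun _ => {s : Set B | MeasurableSet s}

lemma isPiSystem_arrBoxes : IsPiSystem (arrBoxes n₁ n₂ B) :=
  IsPiSystem.pi fun _ => IsPiSystem.pi fun _ => MeasurableSpace.isPiSystem_measurableSet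

lemma isCountablySpanning_arrBoxes : IsCountablySpanning (arrBoxes n₁ n₂ B) :=
  IsCountablySpanning.pi fun _ => IsCountablySpanning.pi fun _ => isCountablySpanning_measurableSet

lemma generateFrom_arrBoxes :
    MeasurableSpace.generateFrom (arrBoxes n₁ n₂ B) = MeasurableSpace.pi :=
  generateFrom_eq_pi (fun _ => generateFrom_pi) fun _ =>
    IsCountablySpanning.pi fun _ => isCountablySpanning_measurableSet

lemma exists_of_mem_arrBoxes {s : Set (Arr n₁ n₂ B)} (hs : s ∈ arrBoxes n₁ n₂ B) :
    ∃ S : Fin n₁ → Fin n₂ → Set B, (∀ i j, MeasurableSet (S i j)) ∧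
      s = {y | ∀ i j, y i j ∈ S i j} := by
  obtain ⟨T, hT, rfl⟩ := hs
  choose S hS hST using fun i => hT i (Set.mem_univ i)
  refine ⟨S, fun i j => hS i j (Set.mem_univ j), ?_⟩
  ext y
  simp [← hST]

/-- A finite measure on arrays is determined by its values on boxes. -/
lemma measure_ext_arrBoxes {m m' : Measure (Arr n₁ n₂ B)} [IsFiniteMeasure m]
    (h : ∀ S : Fin n₁ → Fin n₂ → Set B, (∀ i j, MeasurableSet (S i j)) →
      m {y | ∀ i j, y i j ∈ S i j} = m' {y | ∀ i j, y i j ∈ S i j}) : m = m' := by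
  refine ext_of_generate_finite _ generateFrom_arrBoxes.symm isPiSystem_arrBoxes ?_ ?_
  · intro s hs
    obtain ⟨S, hS, rfl⟩ := exists_of_mem_arrBoxes hs
    exact h S hS
  · simpa using h (fun _ _ => Set.univ) fun _ _ => MeasurableSet.univ

lemma measure_ext_prod_arrBoxes {A : Type*} [MeasurableSpace A]
    {m m' : Measure (A × Arr n₁ n₂ B)} [IsFiniteMeasure m]
    (h : ∀ (s : Set A) (S : Fin n₁ → Fin n₂ → Set B), MeasurableSet s →
      (∀ i j, MeasurableSet (S i j)) →
      m (s ×ˢ {y | ∀ i j, y i j ∈ S i j}) = m' (s ×ˢ {y | ∀ i j, y i j ∈ S i j})) : m = m' := by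
  refine ext_of_generate_finite _ (generateFrom_eq_prod MeasurableSpace.generateFrom_measurableSet
    generateFrom_arrBoxes isCountablySpanning_measurableSet isCountablySpanning_arrBoxes).symm
    (MeasurableSpace.isPiSystem_measurableSet.prod isPiSystem_arrBoxes) ?_ ?_
  · rintro _ ⟨s, hs, t, ht, rfl⟩
    obtain ⟨S, hS, rfl⟩ := exists_of_mem_arrBoxes ht
    exact h s S hs hS
  · simpa using h Set.univ (fun _ _ => Set.univ) MeasurableSet.univ fun _ _ => MeasurableSet.univ

lemma volume_arrBox {B : Type*} [MeasureSpace B] [SigmaFinite (volume : Measure B)]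
    (S : Fin n₁ → Fin n₂ → Set B) :
    (volume : Measure (Arr n₁ n₂ B)) {y | ∀ i j, y i j ∈ S i j} = ∏ i, ∏ j, volume (S i j) := by
  have : {y : Arr n₁ n₂ B | ∀ i j, y i j ∈ S i j}
      = Set.pi Set.univ fun i => Set.pi Set.univ (S i) := by
    ext y; simp
  rw [this, volume_pi_pi]
  exact Finset.prod_congr rfl fun i _ => volume_pi_pi _

end Boxes

/-! ### I.i.d. uniform arrays as arrays with product law -/

section IIDUniform

variable {Ω : Type*} [MeasurableSpace Ω] {μ : Measure Ω} {n₁ n₂ : ℕ}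
  {η : Ω → Arr n₁ n₂ unitInterval}

lemma IsIIDUniform.map_eq_volume [IsProbabilityMeasure μ] (h : IsIIDUniform η μ) :
    μ.map η = volume := by
  refine measure_ext_arrBoxes fun S hS => ?_
  have hbox : MeasurableSet {y : Arr n₁ n₂ unitInterval | ∀ i j, y i j ∈ S i j} := by
    have := hS
    measurability
  rw [volume_arrBox, Measure.map_apply h.measurable hbox]
  have := h.indep.measure_inter_preimage_eq_mul (S := Finset.univ)
    (sets := fun p => S p.1 p.2) fun p _ => hS p.1 p.2
  have hset : η ⁻¹' {y | ∀ i j, y i j ∈ S i j}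
      = ⋂ p ∈ (Finset.univ : Finset (Fin n₁ × Fin n₂)),
        (fun ω => η ω p.1 p.2) ⁻¹' S p.1 p.2 := by
    ext ω; simp
  rw [hset, this, Fintype.prod_prod_type]
  refine Finset.prod_congr rfl fun i _ => Finset.prod_congr rfl fun j _ => ?_
  have hm : Measurable fun ω => η ω i j := by have := h.measurable; fun_prop
  rw [← h.uniform i j, Measure.map_apply hm (hS i j)]

lemma isIIDUniform_of_map_eq_volume [IsProbabilityMeasure μ] (hη : Measurable η)
    (h : μ.map η = volume) : IsIIDUniform η μ := by
  have hu : ∀ i j, μ.map (fun ω => η ω i j) = volume := by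
    intro i j
    have h1 : MeasurePreserving (fun y : Arr n₁ n₂ unitInterval => y i j) :=
      (measurePreserving_eval (fun _ => (volume : Measure unitInterval)) j).comp
        (measurePreserving_eval (fun _ => (volume : Measure (Fin n₂ → unitInterval))) i)
    rw [← h1.map_eq, ← h, Measure.map_map (by fun_prop) hη]
    rfl
  refine ⟨hη, hu, ?_⟩
  rw [iIndepFun_iff_map_fun_eq_pi_map (fun p => by fun_prop)]
  symm
  refine Measure.pi_eq fun S hS => ?_
  rw [Measure.map_apply (by fun_prop) (MeasurableSet.univ_pi hS)]
  have hbox : MeasurableSet {y : Arr n₁ n₂ unitInterval | ∀ i j, y i j ∈ S (i, j)} := by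
    have := hS
    measurability
  have hset : (fun ω (p : Fin n₁ × Fin n₂) => η ω p.1 p.2) ⁻¹' Set.pi Set.univ S
      = η ⁻¹' {y | ∀ i j, y i j ∈ S (i, j)} := by
    ext ω; simp
  rw [hset, ← Measure.map_apply hη hbox, h, volume_arrBox (fun i j => S (i, j)),
    Fintype.prod_prod_type]
  simp only [hu]

end IIDUniform

/-! ### Randomization and transfer -/

section Transfer

/-- Joint law of a random variable and a randomization of it. -/
lemma map_prod_eq_compProd {A B C : Type*} [MeasurableSpace A] [MeasurableSpace B]
    [MeasurableSpace C] (m : Measure A) [SFinite m] (ν : Measure B) [SFinite ν]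
    (κ : Kernel A C) [IsSFiniteKernel κ] {F : A → B → C} (hF : Measurable (Function.uncurry F))
    (h : ∀ᵐ a ∂m, ν.map (F a) = κ a) :
    (m.prod ν).map (fun p => (p.1, F p.1 p.2)) = m ⊗ₘ κ := by
  have hm : Measurable fun p : A × B => (p.1, F p.1 p.2) := measurable_fst.prodMk hF
  ext s hs
  rw [Measure.map_apply hm hs, Measure.prod_apply (hm hs), Measure.compProd_apply hs]
  refine lintegral_congr_ae (h.mono fun a ha => ?_)
  change _ = κ a _
  rw [← ha, Measure.map_apply hF.of_uncurry_left (measurable_prodMk_left hs)]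
  rfl

/-- Transfer: a random variable `Z` can be completed to a pair with any prescribed joint law whose
first marginal is the law of `Z`, on a space with an independent uniform random variable. -/
lemma exists_map_prodMk_eq {Ω A B : Type*} [MeasurableSpace Ω] [MeasurableSpace A]
    [MeasurableSpace B] [StandardBorelSpace B] [Nonempty B] {μ : Measure Ω}
    [IsProbabilityMeasure μ] {Z : Ω → A} (hZ : Measurable Z) {U : Ω → unitInterval}
    (hU : Measurable U) (hUv : μ.map U = volume) (hind : IndepFun U Z μ)
    (ρ : Measure (A × B)) [IsFiniteMeasure ρ] (hρ : ρ.fst = μ.map Z) :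
    ∃ η : Ω → B, Measurable η ∧ μ.map (fun ω => (Z ω, η ω)) = ρ := by
  -- Noise outsourcing: each conditional law of the second coordinate is the image of the uniform
  -- law under φ.
  obtain ⟨φ, hφ, hφκ⟩ := ρ.condKernel.exists_measurable_map_eq_unitInterval
  refine ⟨fun ω => φ (Z ω) (U ω), hφ.comp (hZ.prodMk hU), ?_⟩
  have hjoint := (indepFun_iff_map_prod_eq_prod_map_map hZ.aemeasurable hU.aemeasurable).1
    hind.symm
  have : IsProbabilityMeasure (μ.map Z) := Measure.isProbabilityMeasure_map hZ.aemeasurable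
  calc μ.map (fun ω => (Z ω, φ (Z ω) (U ω)))
      = (μ.map fun ω => (Z ω, U ω)).map (fun p => (p.1, φ p.1 p.2)) := by
        rw [Measure.map_map (by exact measurable_fst.prodMk hφ) (hZ.prodMk hU)]; rfl
    _ = ρ.fst ⊗ₘ ρ.condKernel := by
        rw [hjoint, hUv, map_prod_eq_compProd _ _ ρ.condKernel hφ (ae_of_all _ hφκ), hρ]
    _ = ρ := ρ.disintegrate _

end Transfer

/-- Measurable selection from a finite set. -/
lemma exists_measurable_selection {A ι : Type*} [MeasurableSpace A] [MeasurableSpace ι]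
    [Finite ι] [Nonempty ι] (P : A → ι → Prop) (hP : ∀ i, MeasurableSet {a | P a i}) :
    ∃ s : A → ι, Measurable s ∧ ∀ a i, P a i → P a (s a) := by
  classical
  have := Fintype.ofFinite ι
  suffices ∀ t : Finset ι, ∃ s : A → ι, Measurable s ∧ ∀ a, ∀ i ∈ t, P a i → P a (s a) by
    obtain ⟨s, hs, h⟩ := this Finset.univ
    exact ⟨s, hs, fun a i => h a i (Finset.mem_univ i)⟩
  intro t
  induction t using Finset.induction_on with
  | empty => exact ⟨fun _ => Classical.arbitrary ι, measurable_const, by simp⟩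
  | insert i t _ ih =>
    obtain ⟨s, hs, h⟩ := ih
    refine ⟨fun a => if P a i then i else s a, Measurable.ite (hP i) measurable_const hs, ?_⟩
    intro a k hk hPk
    by_cases hi : P a i
    · simp [hi]
    · rcases Finset.mem_insert.1 hk with rfl | hk
      · exact absurd hPk hi
      · simpa [hi] using h a k hk hPk

/-! ### Permuted broadcast arrays and their marked positions -/

section PermAct

variable {n₁ n₂ : ℕ} {A : Type*}

@[simp]
lemma permAct_inv_permAct (g : SepPerm n₁ n₂) (x : Arr n₁ n₂ A) :
    permAct g⁻¹ (permAct g x) = x := by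
  ext i j; simp [permAct]

lemma measurable_permAct [MeasurableSpace A] (g : SepPerm n₁ n₂) :
    Measurable (permAct g : Arr n₁ n₂ A → Arr n₁ n₂ A) := by
  unfold permAct; fun_prop

lemma measurable_broadcast [MeasurableSpace A] (i : Fin n₁) (j : Fin n₂) :
    Measurable fun x : Arr n₁ n₂ A => broadcast x i j := by
  unfold broadcast; fun_prop

/-- Broadcasting commutes with the action once the marked position is moved along, and `canon`
forgets the outer permutation. -/
lemma IsCanonicalForm.augCanon_permAct [MeasurableSpace A]
    {canon : Arr n₁ n₂ (A × A × A) → Arr n₁ n₂ (A × A × A)} (hcanon : IsCanonicalForm canon)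
    (g : SepPerm n₁ n₂) (x : Arr n₁ n₂ A) (i : Fin n₁) (j : Fin n₂) :
    augCanon canon (permAct g x) i j = augCanon canon x (g.1 i) (g.2 j) :=
  hcanon.invariant g (broadcast x (g.1 i) (g.2 j))

lemma IsCanonicalForm.measurable_augCanon [MeasurableSpace A]
    {canon : Arr n₁ n₂ (A × A × A) → Arr n₁ n₂ (A × A × A)} (hcanon : IsCanonicalForm canon)
    (i : Fin n₁) (j : Fin n₂) : Measurable fun x : Arr n₁ n₂ A => augCanon canon x i j :=
  hcanon.measurable.comp (measurable_broadcast i j)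

/-- The position `(k, l)` in a permuted broadcast array `z` carries the row and the column that
were broadcast. -/
def IsMarkedPosition (z : Arr n₁ n₂ (A × A × A)) (p : Fin n₁ × Fin n₂) : Prop :=
  (∀ l, (z p.1 l).1 = (z p.1 l).2.1) ∧ ∀ k, (z k p.2).1 = (z k p.2).2.2

lemma measurableSet_isMarkedPosition [MeasurableSpace A] [StandardBorelSpace A]
    (p : Fin n₁ × Fin n₂) :
    MeasurableSet {z : Arr n₁ n₂ (A × A × A) | IsMarkedPosition z p} := by
  simp only [IsMarkedPosition, Set.ofPred_and, Set.ofPred_forall]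
  exact (MeasurableSet.iInter fun l => measurableSet_eq_fun (by fun_prop) (by fun_prop)).inter
    (MeasurableSet.iInter fun k => measurableSet_eq_fun (by fun_prop) (by fun_prop))

/-- Every permuted broadcast array has a marked position. -/
lemma exists_isMarkedPosition (g : SepPerm n₁ n₂) (x : Arr n₁ n₂ A) (i : Fin n₁) (j : Fin n₂) :
    ∃ p, IsMarkedPosition (permAct g (broadcast x i j)) p :=
  ⟨(g.1.symm i, g.2.symm j), by simp [IsMarkedPosition, permAct, broadcast]⟩

/-- A marked position of a permuted broadcast array can be moved to the position at which the
array was broadcast. -/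
lemma IsMarkedPosition.exists_permAct_eq {g : SepPerm n₁ n₂} {x : Arr n₁ n₂ A} {i : Fin n₁}
    {j : Fin n₂} {p : Fin n₁ × Fin n₂} (hp : IsMarkedPosition (permAct g (broadcast x i j)) p) :
    ∃ h : SepPerm n₁ n₂, h.1 p.1 = i ∧ h.2 p.2 = j ∧
      (fun k l => (permAct g (broadcast x i j) k l).1) = permAct h x := by
  obtain ⟨hrow, hcol⟩ := hp
  simp only [permAct, broadcast] at hrow hcol
  have hrow' : ∀ l, x (g.1 p.1) l = x i l := fun l => by simpa using hrow (g.2.symm l)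
  have hcol' : ∀ k, x k (g.2 p.2) = x k j := fun k => by simpa using hcol (g.1.symm k)
  -- The permutation g carries p to a position whose row and column in x equal those of (i, j); the
  -- swaps finish the move without altering x.
  refine ⟨(Equiv.swap (g.1 p.1) i * g.1, Equiv.swap (g.2 p.2) j * g.2), by simp, by simp, ?_⟩
  have hr : ∀ k l, x (Equiv.swap (g.1 p.1) i k) l = x k l := by
    intro k l
    rw [Equiv.swap_apply_def]
    split_ifs with h1 h2
    · rw [h1, hrow']
    · rw [h2, hrow']
    · rfl
  have hc : ∀ k l, x k (Equiv.swap (g.2 p.2) j l) = x k l := by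
    intro k l
    rw [Equiv.swap_apply_def]
    split_ifs with h1 h2
    · rw [h1, hcol']
    · rw [h2, hcol']
    · rfl
  ext k l
  simp [permAct, broadcast, hr, hc]

end PermAct

/-! ### Conditional laws of the entries -/

section EntryLaws

variable {Ω A B : Type*} [MeasurableSpace Ω] [MeasurableSpace A] [MeasurableSpace B]
  [StandardBorelSpace B] [Nonempty B] {μ : Measure Ω} [IsProbabilityMeasure μ] {n₁ n₂ : ℕ}
  {X : Ω → Arr n₁ n₂ A} {Y : Ω → Arr n₁ n₂ B}

/-- Conditional equivariance over an exchangeable array is invariance of the joint law. -/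
lemma CondEquivariant.map_permAct_prodMk (h : CondEquivariant X Y μ)
    (hexch : SeparatelyExchangeable X μ) (hY : Measurable Y) (g : SepPerm n₁ n₂) :
    μ.map (fun ω => (permAct g (X ω), permAct g (Y ω))) = μ.map fun ω => (X ω, Y ω) := by
  have hgY : Measurable fun ω => permAct g (Y ω) := (measurable_permAct g).comp hY
  rw [← compProd_map_condDistrib hgY.aemeasurable, ← compProd_map_condDistrib hY.aemeasurable,
    hexch g]
  exact Measure.compProd_congr (h g)

/-- Under conditional equivariance, the conditional laws of the entries are permuted along with
the conditioning array. -/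
lemma CondEquivariant.condDistrib_entry (h : CondEquivariant X Y μ)
    (hexch : SeparatelyExchangeable X μ) (hX : Measurable X) (hY : Measurable Y)
    (g : SepPerm n₁ n₂) (i : Fin n₁) (j : Fin n₂) :
    ∀ᵐ x ∂(μ.map X), condDistrib (fun ω => Y ω (g.1 i) (g.2 j)) X μ x
      = condDistrib (fun ω => Y ω i j) X μ (permAct g x) := by
  have hYe : ∀ i j, Measurable fun ω => Y ω i j := fun i j => by fun_prop
  have hg := measurable_permAct (A := A) g
  have hg' := measurable_permAct (A := A) g⁻¹
  have hgX : Measurable fun ω => permAct g (X ω) := hg.comp hX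
  have hgY : Measurable fun ω => permAct g (Y ω) := (measurable_permAct g).comp hY
  have hXm : (μ.map X).map (permAct g) = μ.map X := by
    rw [Measure.map_map hg hX]; exact hexch g
  have hentry : μ.map (fun ω => (permAct g (X ω), Y ω (g.1 i) (g.2 j)))
      = μ.map fun ω => (X ω, Y ω i j) := by
    have hp : Measurable fun p : Arr n₁ n₂ A × Arr n₁ n₂ B => (p.1, p.2 i j) := by fun_prop
    have := congrArg (Measure.map fun p : Arr n₁ n₂ A × Arr n₁ n₂ B => (p.1, p.2 i j))
      (h.map_permAct_prodMk hexch hY g)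
    rwa [Measure.map_map hp (hgX.prodMk hgY), Measure.map_map hp (hX.prodMk hY)] at this
  -- By uniqueness of disintegration, it suffices that the pulled-back kernel yields the right joint
  -- law, checked on rectangles.
  refine condDistrib_ae_eq_of_measure_eq_compProd_of_measurable hX (hYe _ _)
    (κ := (condDistrib (fun ω => Y ω i j) X μ).comap (permAct g) hg) ?_
  refine Measure.ext_prod fun {s t} hs ht => ?_
  have hst : s = permAct g ⁻¹' (permAct g⁻¹ ⁻¹' s) := by
    ext x; simp
  have hκ := Kernel.measurable_coe (condDistrib (fun ω => Y ω i j) X μ) ht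
  calc μ.map (fun ω => (X ω, Y ω (g.1 i) (g.2 j))) (s ×ˢ t)
      = μ.map (fun ω => (permAct g (X ω), Y ω (g.1 i) (g.2 j))) ((permAct g⁻¹ ⁻¹' s) ×ˢ t) := by
        rw [Measure.map_apply (hX.prodMk (hYe _ _)) (hs.prod ht),
          Measure.map_apply (hgX.prodMk (hYe _ _)) ((hg' hs).prod ht)]
        congr 1
        ext ω; simp
    _ = ∫⁻ x in permAct g⁻¹ ⁻¹' s, condDistrib (fun ω => Y ω i j) X μ x t ∂(μ.map X) := by
        rw [hentry, ← compProd_map_condDistrib (hYe i j).aemeasurable,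
          Measure.compProd_apply_prod (hg' hs) ht]
    _ = ∫⁻ x in s, condDistrib (fun ω => Y ω i j) X μ (permAct g x) t ∂(μ.map X) := by
        -- Exchangeability enters as a change of variables x ↦ g·x.
        conv_lhs => rw [← hXm]
        rw [setLIntegral_map (hg' hs) hκ hg, ← hst]
    _ = _ := by
        rw [Measure.compProd_apply_prod hs ht]; rfl

/-- Conditional independence of the entries: joint probabilities in terms of the conditional laws
of the entries. -/
lemma CondIndepEntries.measure_inter_eq (hci : CondIndepEntries X Y μ) (hX : Measurable X)
    (hY : Measurable Y) {s : Set (Arr n₁ n₂ A)} (hs : MeasurableSet s)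
    (S : Fin n₁ → Fin n₂ → Set B) (hS : ∀ i j, MeasurableSet (S i j)) :
    μ (X ⁻¹' s ∩ Y ⁻¹' {y | ∀ i j, y i j ∈ S i j})
      = ∫⁻ x in s, ∏ i, ∏ j, condDistrib (fun ω => Y ω i j) X μ x (S i j) ∂(μ.map X) := by
  have hYe : ∀ i j, Measurable fun ω => Y ω i j := fun i j => by fun_prop
  have hbox : MeasurableSet {y : Arr n₁ n₂ B | ∀ i j, y i j ∈ S i j} := by
    have := hS
    measurability
  have hcond : (fun ω => (condDistrib Y X μ (X ω)).real {y | ∀ i j, y i j ∈ S i j})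
      =ᵐ[μ] fun ω => ∏ i, ∏ j, (condDistrib (fun ω => Y ω i j) X μ (X ω)).real (S i j) := by
    have h1 := condDistrib_ae_eq_condExp (μ := μ) hX hY hbox
    have hset : Y ⁻¹' {y | ∀ i j, y i j ∈ S i j} = ⋂ i, ⋂ j, {ω | Y ω i j ∈ S i j} := by
      ext ω; simp
    rw [hset] at h1
    have h2 : ∀ᵐ ω ∂μ, ∀ i j, (condDistrib (fun ω => Y ω i j) X μ (X ω)).real (S i j)
        = (μ⟦{ω | Y ω i j ∈ S i j} | MeasurableSpace.comap X inferInstance⟧) ω := by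
      simp only [ae_all_iff]
      exact fun i j => condDistrib_ae_eq_condExp hX (hYe i j) (hS i j)
    filter_upwards [h1, hci S hS, h2] with ω h1 h3 h2
    rw [h1, h3]
    simp [Finset.prod_apply, h2]
  have hmeas : Measurable fun x =>
      ∏ i, ∏ j, condDistrib (fun ω => Y ω i j) X μ x (S i j) :=
    Finset.measurable_prod _ fun i _ => Finset.measurable_prod _ fun j _ =>
      Kernel.measurable_coe _ (hS i j)
  rw [← setLIntegral_preimage_condDistrib hX hY.aemeasurable hbox hs,
    setLIntegral_map hs hmeas hX]
  refine lintegral_congr_ae (ae_restrict_of_ae (hcond.mono fun ω hω => ?_))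
  rw [← ENNReal.toReal_eq_toReal_iff' (measure_ne_top _ _)
    (ENNReal.prod_ne_top fun i _ => ENNReal.prod_ne_top fun j _ => measure_ne_top _ _)]
  simpa [ENNReal.toReal_prod, Measure.real] using hω

/-- Conditionally independent entries are jointly distributed as a randomization by independent
uniform variables, entry by entry. -/
lemma CondIndepEntries.map_prodMk_eq (hci : CondIndepEntries X Y μ) (hX : Measurable X)
    (hY : Measurable Y) {G : Fin n₁ → Fin n₂ → Arr n₁ n₂ A → unitInterval → B}
    (hG : ∀ i j, Measurable (Function.uncurry (G i j)))
    (hGlaw : ∀ᵐ x ∂(μ.map X), ∀ i j,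
      (volume : Measure unitInterval).map (G i j x) = condDistrib (fun ω => Y ω i j) X μ x) :
    ((μ.map X).prod (volume : Measure (Arr n₁ n₂ unitInterval))).map
        (fun p => (p.1, fun i j => G i j p.1 (p.2 i j))) = μ.map fun ω => (X ω, Y ω) := by
  have : IsProbabilityMeasure (μ.map X) := Measure.isProbabilityMeasure_map hX.aemeasurable
  have hm : Measurable fun p : Arr n₁ n₂ A × Arr n₁ n₂ unitInterval =>
      (p.1, (fun i j => G i j p.1 (p.2 i j) : Arr n₁ n₂ B)) := by
    refine measurable_fst.prodMk (measurable_pi_lambda _ fun i => measurable_pi_lambda _ fun j => ?_)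
    exact (hG i j).comp (measurable_fst.prodMk (by fun_prop))
  refine measure_ext_prod_arrBoxes fun s S hs hS => ?_
  have hbox : MeasurableSet {y : Arr n₁ n₂ B | ∀ i j, y i j ∈ S i j} := by
    have := hS
    measurability
  rw [Measure.map_apply hm (hs.prod hbox), Measure.map_apply (hX.prodMk hY) (hs.prod hbox),
    Set.mk_preimage_prod X Y, hci.measure_inter_eq hX hY hs S hS,
    Measure.prod_apply (hm (hs.prod hbox)), ← lintegral_indicator hs]
  refine lintegral_congr_ae (hGlaw.mono fun x hx => ?_)
  by_cases hxs : x ∈ s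
  · simp only [Set.indicator_of_mem hxs, ← hx]
    have hset : (Prod.mk x ⁻¹' ((fun p : Arr n₁ n₂ A × Arr n₁ n₂ unitInterval =>
        (p.1, (fun i j => G i j p.1 (p.2 i j) : Arr n₁ n₂ B))) ⁻¹'
          (s ×ˢ {y | ∀ i j, y i j ∈ S i j})))
        = {e | ∀ i j, e i j ∈ G i j x ⁻¹' S i j} := by
      ext e; simp [hxs]
    rw [hset, volume_arrBox]
    refine Finset.prod_congr rfl fun i _ => Finset.prod_congr rfl fun j _ => ?_
    rw [Measure.map_apply (hG i j).of_uncurry_left (hS i j)]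
  · simp [Set.preimage, hxs]

end EntryLaws

/-! ### Entrywise randomization and its equivariance -/

section Randomize

variable {A B : Type*} [MeasurableSpace A] {n₁ n₂ : ℕ}
  {canon : Arr n₁ n₂ (A × A × A) → Arr n₁ n₂ (A × A × A)}

/-- The array generated entrywise by `f` from the noise `e` and the array `x`. -/
def randomize (canon : Arr n₁ n₂ (A × A × A) → Arr n₁ n₂ (A × A × A))
    (f : unitInterval × A × Arr n₁ n₂ (A × A × A) → B) (x : Arr n₁ n₂ A)
    (e : Arr n₁ n₂ unitInterval) : Arr n₁ n₂ B :=
  fun i j => f (e i j, x i j, augCanon canon x i j)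

lemma IsCanonicalForm.measurable_randomize [MeasurableSpace B]
    (hcanon : IsCanonicalForm canon) {f : unitInterval × A × Arr n₁ n₂ (A × A × A) → B} (hf : Measurable f) :
    Measurable (Function.uncurry (randomize canon f)) := by
  refine measurable_pi_lambda _ fun i => measurable_pi_lambda _ fun j => hf.comp ?_
  have := hcanon.measurable_augCanon i j
  exact (by fun_prop : Measurable fun p : Arr n₁ n₂ A × Arr n₁ n₂ unitInterval => p.2 i j).prodMk
    ((by fun_prop : Measurable fun p : Arr n₁ n₂ A × Arr n₁ n₂ unitInterval => p.1 i j).prodMk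
      (this.comp measurable_fst))

lemma IsCanonicalForm.randomize_permAct (hcanon : IsCanonicalForm canon)
    (f : unitInterval × A × Arr n₁ n₂ (A × A × A) → B) (g : SepPerm n₁ n₂) (x : Arr n₁ n₂ A)
    (e : Arr n₁ n₂ unitInterval) :
    randomize canon f (permAct g x) (permAct g e) = permAct g (randomize canon f x e) := by
  ext i j
  simp [randomize, permAct, ← hcanon.augCanon_permAct g x i j]

end Randomize

lemma IsIIDUniform.permAct {Ω : Type*} [MeasurableSpace Ω] {μ : Measure Ω} {n₁ n₂ : ℕ}
    {η : Ω → Arr n₁ n₂ unitInterval} (h : IsIIDUniform η μ)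
    (g : SepPerm n₁ n₂) : IsIIDUniform (fun ω => permAct g (η ω)) μ where
  measurable := (measurable_permAct g).comp h.measurable
  uniform i j := h.uniform (g.1 i) (g.2 j)
  indep := h.indep.precomp (g := Prod.map g.1 g.2) (g.1.injective.prodMap g.2.injective)

/-! ### The two directions of the representation -/

section Representation

variable {Ω A B : Type*} [MeasurableSpace Ω] [MeasurableSpace A] [MeasurableSpace B]
  [StandardBorelSpace B] [Nonempty B] {μ : Measure Ω} [IsProbabilityMeasure μ] {n₁ n₂ : ℕ}
  {X : Ω → Arr n₁ n₂ A} {Y : Ω → Arr n₁ n₂ B}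
  {canon : Arr n₁ n₂ (A × A × A) → Arr n₁ n₂ (A × A × A)}

/-- Under conditional equivariance, one measurable function of a uniform variable and the
augmented canonical form represents the conditional laws of all entries. -/
lemma CondEquivariant.exists_map_eq_condDistrib [StandardBorelSpace A]
    (h : CondEquivariant X Y μ) (hcanon : IsCanonicalForm canon)
    (hexch : SeparatelyExchangeable X μ) (hX : Measurable X) (hY : Measurable Y) :
    ∃ f : unitInterval × A × Arr n₁ n₂ (A × A × A) → B, Measurable f ∧
      ∀ᵐ x ∂(μ.map X), ∀ i j, (volume : Measure unitInterval).map
        (fun u => f (u, x i j, augCanon canon x i j)) = condDistrib (fun ω => Y ω i j) X μ x := by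
  rcases isEmpty_or_nonempty (Fin n₁ × Fin n₂) with hemp | hne
  · exact ⟨fun _ => Classical.arbitrary B, measurable_const,
      ae_of_all _ fun x i j => (hemp.false (i, j)).elim⟩
  have hrep : ∀ p : Fin n₁ × Fin n₂, ∃ G : Arr n₁ n₂ A → unitInterval → B,
      Measurable (Function.uncurry G) ∧
        ∀ x, volume.map (G x) = condDistrib (fun ω => Y ω p.1 p.2) X μ x :=
    fun p => (condDistrib (fun ω => Y ω p.1 p.2) X μ).exists_measurable_map_eq_unitInterval
  choose G hG hGlaw using hrep
  obtain ⟨s, hs, hsel⟩ := exists_measurable_selection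
    (IsMarkedPosition : Arr n₁ n₂ (A × A × A) → _ → Prop) measurableSet_isMarkedPosition
  -- Sample the entry at the selected marked position, given the orbit representative stored in the
  -- first coordinates. The canonical form already determines x i j, so the second argument is not
  -- needed.
  refine ⟨fun q => G (s q.2.2) (fun k l => (q.2.2 k l).1) q.1, ?_, ?_⟩
  · have hG' : Measurable fun r : (Fin n₁ × Fin n₂) × Arr n₁ n₂ A × unitInterval =>
        G r.1 r.2.1 r.2.2 :=
      measurable_from_prod_countable_right hG
    exact hG'.comp (f := fun q : unitInterval × A × Arr n₁ n₂ (A × A × A) =>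
      (s q.2.2, (fun k l => (q.2.2 k l).1 : Arr n₁ n₂ A), q.1)) (by fun_prop)
  · have hequiv : ∀ᵐ x ∂(μ.map X), ∀ (g : SepPerm n₁ n₂) i j,
        condDistrib (fun ω => Y ω (g.1 i) (g.2 j)) X μ x
          = condDistrib (fun ω => Y ω i j) X μ (permAct g x) := by
      simp only [ae_all_iff]
      exact fun g i j => h.condDistrib_entry hexch hX hY g i j
    filter_upwards [hequiv] with x hx i j
    obtain ⟨g, hg⟩ := hcanon.mem_orbit (broadcast x i j)
    obtain ⟨p, hp⟩ := exists_isMarkedPosition g x i j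
    obtain ⟨k, hk₁, hk₂, hkx⟩ := (hsel _ p hp).exists_permAct_eq
    change volume.map (G (s (canon (broadcast x i j)))
      fun k l => (canon (broadcast x i j) k l).1) = _
    -- Here k takes the selected position to (i, j) and x to the stored representative, so
    -- equivariance along k identifies the two laws.
    rw [hg, hGlaw, hkx, ← hx k]
    simp only [hk₁, hk₂]

/-- An array generated entrywise from the augmented canonical form with independent uniform noise
is conditionally equivariant. -/
lemma condEquivariant_of_randomize (hcanon : IsCanonicalForm canon) (hX : Measurable X)
    (hexch : SeparatelyExchangeable X μ)
    {f : unitInterval × A × Arr n₁ n₂ (A × A × A) → B} (hf : Measurable f)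
    {η : Ω → Arr n₁ n₂ unitInterval} (hη : IsIIDUniform η μ) (hind : IndepFun η X μ)
    (hYf : ∀ᵐ ω ∂μ, Y ω = randomize canon f (X ω) (η ω)) : CondEquivariant X Y μ := by
  have hF := hcanon.measurable_randomize hf
  -- The right-hand side does not involve g, which is the invariance of the joint law.
  have hjoint : ∀ g : SepPerm n₁ n₂,
      μ.map (fun ω => (permAct g (X ω), permAct g (Y ω)))
        = ((μ.map X).prod volume).map fun p => (p.1, randomize canon f p.1 p.2) := by
    intro g
    have hgX : Measurable fun ω => permAct g (X ω) := (measurable_permAct g).comp hX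
    have hgη := hη.permAct g
    have hind' : IndepFun (fun ω => permAct g (X ω)) (fun ω => permAct g (η ω)) μ :=
      hind.symm.comp (measurable_permAct g) (measurable_permAct g)
    have hp : Measurable fun p : Arr n₁ n₂ A × Arr n₁ n₂ unitInterval =>
        (p.1, randomize canon f p.1 p.2) := measurable_fst.prodMk hF
    rw [← hexch g, ← hgη.map_eq_volume, ← (indepFun_iff_map_prod_eq_prod_map_map
      hgX.aemeasurable hgη.measurable.aemeasurable).1 hind',
      Measure.map_map hp (hgX.prodMk hgη.measurable)]
    refine Measure.map_congr (hYf.mono fun ω hω => ?_)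
    simp [hω, hcanon.randomize_permAct]
  intro g
  refine ae_of_all _ fun x => ?_
  have h1 : μ.map (fun ω => (X ω, Y ω))
      = ((μ.map X).prod volume).map fun p => (p.1, randomize canon f p.1 p.2) := hjoint 1
  have : condDistrib (fun ω => permAct g (Y ω)) (fun ω => permAct g (X ω)) μ
      = condDistrib Y X μ := by
    -- `condDistrib` is built from the joint law alone, so equal joint laws give equality at every
    -- x.
    rw [condDistrib, condDistrib]
    congr 1
    rw [hjoint g, h1]
  rw [this]

/-- On a rich enough space, a variable whose joint law with `X` is that of a function of `X` and
independent noise is almost surely such a function. -/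
lemma exists_ae_eq_of_map_eq {A B E : Type*} [MeasurableSpace A] [MeasurableSpace B]
    [MeasurableEq B] [MeasurableSpace E] [StandardBorelSpace E] [Nonempty E] {X : Ω → A}
    {Y : Ω → B} (hX : Measurable X) (hY : Measurable Y) {U : Ω → unitInterval}
    (hU : Measurable U) (hUv : μ.map U = volume) (hUind : IndepFun U (fun ω => (X ω, Y ω)) μ)
    (ν : Measure E) [IsProbabilityMeasure ν] {F : A → E → B}
    (hF : Measurable (Function.uncurry F))
    (hlaw : ((μ.map X).prod ν).map (fun p => (p.1, F p.1 p.2)) = μ.map fun ω => (X ω, Y ω)) :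
    ∃ η : Ω → E, Measurable η ∧ μ.map η = ν ∧ IndepFun η X μ ∧ ∀ᵐ ω ∂μ, Y ω = F (X ω) (η ω) := by
  have : IsProbabilityMeasure (μ.map X) := Measure.isProbabilityMeasure_map hX.aemeasurable
  have hp : Measurable fun p : A × E => ((p.1, F p.1 p.2), p.2) :=
    (measurable_fst.prodMk hF).prodMk measurable_snd
  -- Prescribe the law of ((X, F(X, e)), e) with e ~ ν independent of X; by `hlaw` its first
  -- marginal is the law of (X, Y). The identity Y = F(X, η) then holds almost surely, as it holds
  -- under this law.
  obtain ⟨η, hη, hηlaw⟩ := exists_map_prodMk_eq (hX.prodMk hY) hU hUv hUind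
    (((μ.map X).prod ν).map fun p => ((p.1, F p.1 p.2), p.2))
    (by rw [Measure.fst, Measure.map_map measurable_fst hp, ← hlaw]; rfl)
  have hXη : μ.map (fun ω => (X ω, η ω)) = (μ.map X).prod ν := by
    have hq : Measurable fun q : (A × B) × E => (q.1.1, q.2) := by fun_prop
    have := congrArg (Measure.map fun q : (A × B) × E => (q.1.1, q.2)) hηlaw
    rw [Measure.map_map hq ((hX.prodMk hY).prodMk hη), Measure.map_map hq hp] at this
    exact this.trans Measure.map_id
  have hην : μ.map η = ν := by
    have := congrArg Measure.snd hXη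
    rwa [Measure.snd_map_prodMk hX, Measure.snd_prod] at this
  refine ⟨η, hη, hην, ?_, ?_⟩
  · refine IndepFun.symm ?_
    rw [indepFun_iff_map_prod_eq_prod_map_map hX.aemeasurable hη.aemeasurable, hXη, hην]
  · have hset : MeasurableSet {q : (A × B) × E | q.1.2 = F q.1.1 q.2} :=
      measurableSet_eq_fun (by fun_prop)
        (hF.comp (by fun_prop : Measurable fun q : (A × B) × E => (q.1.1, q.2)))
    have : ∀ᵐ q ∂(μ.map fun ω => ((X ω, Y ω), η ω)), q.1.2 = F q.1.1 q.2 := by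
      rw [hηlaw, ae_map_iff hp.aemeasurable hset]
      exact ae_of_all _ fun _ => rfl
    rwa [ae_map_iff ((hX.prodMk hY).prodMk hη).aemeasurable hset] at this

end Representation

theorem theorem14 {Ω 𝒳 𝒴 : Type*} [MeasurableSpace Ω]
    [MeasurableSpace 𝒳] [StandardBorelSpace 𝒳]
    [MeasurableSpace 𝒴] [StandardBorelSpace 𝒴] [Nonempty 𝒴]
    (μ : Measure Ω) [IsProbabilityMeasure μ] {n₁ n₂ : ℕ}
    (canon : Arr n₁ n₂ (𝒳 × 𝒳 × 𝒳) → Arr n₁ n₂ (𝒳 × 𝒳 × 𝒳)) (hcanon : IsCanonicalForm canon)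
    (X : Ω → Arr n₁ n₂ 𝒳) (hX : Measurable X)
    (Y : Ω → Arr n₁ n₂ 𝒴) (hY : Measurable Y)
    -- the background probability space is rich enough: it carries a uniform random variable
    -- that is independent of `(X, Y)`
    (hrich : ∃ U : Ω → unitInterval, Measurable U ∧ μ.map U = volume ∧
      IndepFun U (fun ω => (X ω, Y ω)) μ)
    (hexch : SeparatelyExchangeable X μ)
    (hci : CondIndepEntries X Y μ) :
    CondEquivariant X Y μ ↔
      ∃ f : unitInterval × 𝒳 × Arr n₁ n₂ (𝒳 × 𝒳 × 𝒳) → 𝒴, Measurable f ∧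
        ∃ η : Ω → Arr n₁ n₂ unitInterval, IsIIDUniform η μ ∧ IndepFun η X μ ∧
          ∀ᵐ ω ∂μ, ∀ i j, Y ω i j = f (η ω i j, X ω i j, augCanon canon (X ω) i j) := by

  constructor
  · intro h
    obtain ⟨f, hf, hflaw⟩ := h.exists_map_eq_condDistrib hcanon hexch hX hY
    obtain ⟨U, hU, hUv, hUind⟩ := hrich
    have hG : ∀ i j, Measurable (Function.uncurry fun (x : Arr n₁ n₂ 𝒳) (u : unitInterval) =>
        f (u, x i j, augCanon canon x i j)) := fun i j => by
      have := hcanon.measurable_augCanon i j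
      exact hf.comp (measurable_snd.prodMk ((by fun_prop :
        Measurable fun p : Arr n₁ n₂ 𝒳 × unitInterval => p.1 i j).prodMk
          (this.comp measurable_fst)))
    obtain ⟨η, hη, hηv, hηX, hYη⟩ := exists_ae_eq_of_map_eq hX hY hU hUv hUind volume
      (hcanon.measurable_randomize hf) (hci.map_prodMk_eq hX hY hG hflaw)
    exact ⟨f, hf, η, isIIDUniform_of_map_eq_volume hη hηv, hηX,
      hYη.mono fun ω hω i j => congrFun (congrFun hω i) j⟩
  · rintro ⟨f, hf, η, hη, hind, hYη⟩
    exact condEquivariant_of_randomize hcanon hX hexch hf hη hind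
      (hYη.mono fun ω hω => funext fun i => funext fun j => hω i j)
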